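/- **Setting.** For $K\ge 1$ let $\Theta_K$ be the set of pairs $\theta=(\pi,H)$ with $\pi_a>0$ for all $a\in[K]=\{1,\dots,K\}$, $\sum_{a=1}^K\pi_a=1$, and $H$ a symmetric $K\times K$ matrix with entries in $(0,1)$. Under the stochastic block model $\mathbb P_\theta$ on $n$ nodes, the latent labels $Z_1,\dots,Z_n\in[K]$ are i.i.d. with $\mathbb P(Z_i=a)=\pi_a$ and, given $Z$, the entries $A_{i,j}$, $i<j$, of the adjacency matrix are independent with $A_{i,j}\sim\mathrm{Bernoulli}(H_{Z_i,Z_j})$; moreover $A_{j,i}=A_{i,j}$ and $A_{i,i}=0$. For $\theta\in\Theta_{K'}$ the likelihood of $A$ is $g(A;\theta)=\sum_{z\in[K']^n}f(z,A;\theta)$, where $$f(z,A;\theta)=\Big(\prod_{a=1}^{K'}\pi_a^{n_a(z)}\Big)\Big(\prod_{a,b=1}^{K'}H_{a,b}^{O_{a,b}(z)}(1-H_{a,b})^{n_{a,b}(z)-O_{a,b}(z)}\Big)^{1/2},$$ $n_a(z)=\sum_i\mathbb I(z_i=a)$, $n_{a,b}(z)=\sum_i\sum_{j\ne i}\mathbb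 I(z_i=a,z_j=b)$, $O_{a,b}(z)=\sum_i\sum_{j\neq i}\mathbb I(z_i=a,z_j=b)A_{i,j}$. The graph on $n$ nodes is generated by $\theta^*=\theta^*_n=(\pi^*,\rho_nS^*)\in\Theta_K$, where $K$, $\pi^*$ and the symmetric matrix $S^*$ do not depend on $n$, $S^*$ has no two identical columns, $\rho_n>0$, and $n\rho_n/\log n\to\infty$. Let $(N_k)_{k\ge1}$ be a strictly increasing real sequence, $(B_n)$ a real sequence, and $$\beta(K')=\sup_{\theta\in\Theta_{K'}}\log g(A;\theta)-N_{K'}B_n .$$ **Statement.** 1. If $B_n=o(n^2\rho_n)$, then for every $1\le K'<K$, $\ \mathbb P_{\theta^*}(\beta(K')<\beta(K))\to1$ as $n\to\infty$. 2. If $B_nn^{-3/2}\rho_n^{-1/2}\to\infty$, then for every $K'>K$, $\ \mathbb P_{\theta^*}(\beta(K')<\beta(K))\to1$ as $n\to\infty$. 3. Consequently, if both conditions on $B_n$ hold, then for every fixed $K_{\max}\ge K$, with probability tending to one $K$ is the unique maximizer of $\beta(K')$ over $K'\in\{1,\dots,K_{\max}\}$. -/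

import Mathlib

open Filter Topology MeasureTheory

namespace SBM

/-- A parameter `θ = (π, H)` of a stochastic block model with `K` blocks: block proportions and
the matrix of connection probabilities. -/
structure Param (K : ℕ) where
  /-- the block proportions `π` -/
  prop : Fin K → ℝ
  /-- the connectivity matrix `H` -/
  conn : Matrix (Fin K) (Fin K) ℝ

/-- The parameter space `Θ_K`: positive block proportions summing to one, and a symmetric matrix
with entries in `(0, 1)`. For `K ≥ 2` the first two conditions give `π ∈ (0, 1) ^ K`; for `K = 1`
they give `π = 1` (the Erdős–Rényi model). -/
def Theta (K : ℕ) : Set (Param K) :=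
  {θ | (∀ a, 0 < θ.prop a) ∧ ∑ a, θ.prop a = 1 ∧ θ.conn.IsSymm ∧
    ∀ a b, θ.conn a b ∈ Set.Ioo (0 : ℝ) 1}

/-- The unordered pairs of distinct nodes, each listed once as `(i, j)` with `i < j`. -/
abbrev Pair (n : ℕ) : Type := {e : Fin n × Fin n // e.1 < e.2}

/-- The undirected graph on `n` nodes with edge indicators `y`. -/
def graphOf {n : ℕ} (y : Pair n → Bool) : SimpleGraph (Fin n) :=
  SimpleGraph.fromRel fun i j => ∃ h : i < j, y ⟨(i, j), h⟩ = true

/-- The Bernoulli distribution with success probability `p` (clamped to `[0, 1]`, which changes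
nothing for connection probabilities of a parameter in `Theta K`). -/
noncomputable def bernoulliLaw (p : ℝ) : Measure Bool :=
  ProbabilityTheory.bernoulliMeasure true false (Set.projIcc (0 : ℝ) 1 zero_le_one p)

/-- The distribution of one latent label: label `a` with probability `π_a`. -/
noncomputable def labelLaw {K : ℕ} (θ : Param K) : Measure (Fin K) :=
  ∑ a, ENNReal.ofReal (θ.prop a) • Measure.dirac a

/-- The distribution of the latent label vector `Z = (Z_1, …, Z_n)`: independent labels. -/
noncomputable def labelsLaw {K : ℕ} (n : ℕ) (θ : Param K) : Measure (Fin n → Fin K) :=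
  Measure.pi fun _ => labelLaw θ

/-- The conditional distribution of the graph given the labels `Z = z`: the edges are independent,
and `{i, j}` is present with probability `H_{z_i, z_j}`. -/
noncomputable def condLaw {n K : ℕ} (θ : Param K) (z : Fin n → Fin K) :
    Measure (SimpleGraph (Fin n)) :=
  (Measure.pi fun e : Pair n => bernoulliLaw (θ.conn (z e.1.1) (z e.1.2))).map graphOf

/-- The distribution `ℙ_θ` of the observed graph on `n` nodes under the stochastic block model
with parameter `θ`. -/
noncomputable def law {K : ℕ} (n : ℕ) (θ : Param K) : Measure (SimpleGraph (Fin n)) :=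
  (labelsLaw n θ).bind (condLaw θ)

section Likelihood

variable {n K : ℕ}

/-- `n_a(z)`, the number of nodes labelled `a`. -/
def nodeCount (z : Fin n → Fin K) (a : Fin K) : ℕ :=
  ∑ i, if z i = a then 1 else 0

/-- `n_{a,b}(z)`, the number of ordered pairs of distinct nodes labelled `a` and `b`. -/
def pairCount (z : Fin n → Fin K) (a b : Fin K) : ℕ :=
  ∑ i, ∑ j, if j ≠ i ∧ z i = a ∧ z j = b then 1 else 0

open Classical in
/-- `O_{a,b}(z)`, the sum of the entries `A_{i,j}` of the adjacency matrix over the ordered pairs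
of distinct nodes labelled `a` and `b`. -/
noncomputable def edgeCount (G : SimpleGraph (Fin n)) (z : Fin n → Fin K) (a b : Fin K) : ℕ :=
  ∑ i, ∑ j, if j ≠ i ∧ z i = a ∧ z j = b then G.adjMatrix ℕ i j else 0

/-- The complete likelihood `f(z, A; θ)`. -/
noncomputable def completeLikelihood (z : Fin n → Fin K) (G : SimpleGraph (Fin n))
    (θ : Param K) : ℝ :=
  (∏ a, θ.prop a ^ nodeCount z a) *
    Real.sqrt (∏ a, ∏ b, θ.conn a b ^ edgeCount G z a b *
      (1 - θ.conn a b) ^ (pairCount z a b - edgeCount G z a b))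

/-- The likelihood `g(A; θ)`, the sum of the complete likelihood over all label vectors. -/
noncomputable def likelihood (G : SimpleGraph (Fin n)) (θ : Param K) : ℝ :=
  ∑ z : Fin n → Fin K, completeLikelihood z G θ

end Likelihood

/-- `sup_{θ ∈ Θ_K} log g(A; θ)`. -/
noncomputable def maxLogLikelihood {n : ℕ} (K : ℕ) (G : SimpleGraph (Fin n)) : ℝ :=
  sSup ((fun θ : Param K => Real.log (likelihood G θ)) '' Theta K)

/-- The penalized likelihood criterion `β(K) = sup_{θ ∈ Θ_K} log g(A; θ) - N_K B`. -/
noncomputable def criterion (N : ℕ → ℝ) (B : ℝ) {n : ℕ} (G : SimpleGraph (Fin n)) (K : ℕ) : ℝ :=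
  maxLogLikelihood K G - N K * B

/-- The set `argmax` of the criterion over the candidate block numbers `1, …, Kmax`. -/
def selected (N : ℕ → ℝ) (B : ℝ) (Kmax : ℕ) {n : ℕ} (G : SimpleGraph (Fin n)) : Set ℕ :=
  {k | k ∈ Set.Icc 1 Kmax ∧ IsMaxOn (criterion N B G) (Set.Icc 1 Kmax) k}

end SBM

namespace SBM

variable {n K : ℕ}

/-- The probability of the label vector `z` when labels are independent with law `p`. -/
def labelProb (p : Fin K → ℝ) (z : Fin n → Fin K) : ℝ := ∏ i, p (z i)

/-- The conditional probability of the edge indicators `y` given the labels `z`. -/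
def edgeProb (H : Matrix (Fin K) (Fin K) ℝ) (z : Fin n → Fin K) (y : Pair n → Bool) : ℝ :=
  ∏ e, if y e then H (z e.1.1) (z e.1.2) else 1 - H (z e.1.1) (z e.1.2)

instance : MeasurableSingletonClass (SimpleGraph (Fin n)) where
  measurableSet_singleton G := by
    have h : ({G} : Set (SimpleGraph (Fin n))) = SimpleGraph.Adj ⁻¹' {G.Adj} := by
      ext G'
      simp
    rw [h]
    exact SimpleGraph.measurable_adj (measurableSet_singleton _)

lemma bernoulliLaw_singleton {q : ℝ} (hq : q ∈ Set.Ioo (0 : ℝ) 1) (b : Bool) :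
    bernoulliLaw q {b} = ENNReal.ofReal (if b then q else 1 - q) := by
  have h : (Set.projIcc (0 : ℝ) 1 zero_le_one q : ℝ) = q := by
    rw [Set.projIcc_of_mem zero_le_one (Set.Ioo_subset_Icc_self hq)]
  classical
  rw [bernoulliLaw, ProbabilityTheory.bernoulliMeasure_apply _ (measurableSet_singleton b)]
  have h2 := unitInterval.coe_symm_eq (Set.projIcc (0 : ℝ) 1 zero_le_one q)
  rw [h] at h2
  cases b
  · simp only [Set.mem_singleton_iff, Bool.true_eq_false, if_false, if_true, Bool.false_eq_true]
    rw [← h2, ENNReal.ofReal]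
    congr 1
    ext
    simpa using Subtype.property (Set.projIcc _ _ _ _) |>.1
  · simp only [Set.mem_singleton_iff, if_true, Bool.false_eq_true, if_false]
    nth_rw 2 [← h]
    rw [ENNReal.ofReal]
    congr 1
    ext
    simpa using Subtype.property (Set.projIcc _ _ _ _) |>.1

instance (θ : Param K) : IsFiniteMeasure (labelLaw θ) := by
  refine ⟨?_⟩
  simp only [labelLaw, Measure.finsetSum_apply, Measure.smul_apply, smul_eq_mul]
  exact ENNReal.sum_lt_top.2 fun a _ => by simp

lemma labelLaw_singleton (θ : Param K) (a : Fin K) :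
    labelLaw θ {a} = ENNReal.ofReal (θ.prop a) := by
  simp [labelLaw, Measure.finsetSum_apply, Set.indicator_apply, eq_comm]

lemma labelsLaw_singleton {θ : Param K} (hθ : θ ∈ Theta K) (z : Fin n → Fin K) :
    labelsLaw n θ {z} = ENNReal.ofReal (labelProb θ.prop z) := by
  rw [labelsLaw, Measure.pi_singleton, labelProb,
    ENNReal.ofReal_prod_of_nonneg fun _ _ => (hθ.1 _).le]
  simp [labelLaw_singleton]

lemma labelProb_pos {p : Fin K → ℝ} (hp : ∀ a, 0 < p a) (z : Fin n → Fin K) :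
    0 < labelProb p z := Finset.prod_pos fun _ _ => hp _

lemma edgeProb_pos {H : Matrix (Fin K) (Fin K) ℝ} (hH : ∀ a b, H a b ∈ Set.Ioo (0 : ℝ) 1)
    (z : Fin n → Fin K) (y : Pair n → Bool) : 0 < edgeProb H z y := by
  refine Finset.prod_pos fun e _ => ?_
  have := hH (z e.1.1) (z e.1.2)
  split_ifs <;> linarith [this.1, this.2]

open Classical in
lemma condLaw_apply {θ : Param K} (hθ : θ ∈ Theta K) (z : Fin n → Fin K)
    (E : Set (SimpleGraph (Fin n))) :
    condLaw θ z E
      = ENNReal.ofReal (∑ y : Pair n → Bool, if graphOf y ∈ E then edgeProb θ.conn z y else 0) := by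
  have : ∀ e : Pair n, IsFiniteMeasure (bernoulliLaw (θ.conn (z e.1.1) (z e.1.2))) := by
    intro e; unfold bernoulliLaw; infer_instance
  rw [condLaw, Measure.map_apply (measurable_of_finite _) (Set.toFinite E).measurableSet,
    ENNReal.ofReal_sum_of_nonneg]
  · have h1 : graphOf ⁻¹' E = ((Finset.univ.filter fun y : Pair n → Bool => graphOf y ∈ E) :
        Set (Pair n → Bool)) := by ext; simp
    rw [h1, ← sum_measure_singleton, Finset.sum_filter]
    refine Finset.sum_congr rfl fun y _ => ?_
    split_ifs
    · rw [Measure.pi_singleton, edgeProb, ENNReal.ofReal_prod_of_nonneg]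
      · exact Finset.prod_congr rfl fun e _ => bernoulliLaw_singleton (hθ.2.2.2 _ _) _
      · intro e _
        have := hθ.2.2.2 (z e.1.1) (z e.1.2)
        split_ifs <;> linarith [this.1, this.2]
    · simp
  · intro y _
    split_ifs
    exacts [(edgeProb_pos hθ.2.2.2 _ _).le, le_rfl]

open Classical in
lemma law_real_apply {θ : Param K} (hθ : θ ∈ Theta K) (E : Set (SimpleGraph (Fin n))) :
    (law n θ).real E = ∑ z : Fin n → Fin K, labelProb θ.prop z *
      ∑ y : Pair n → Bool, if graphOf y ∈ E then edgeProb θ.conn z y else 0 := by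
  have h0 : ∀ z : Fin n → Fin K, 0 ≤ ∑ y : Pair n → Bool,
      if graphOf y ∈ E then edgeProb θ.conn z y else 0 := fun z =>
    Finset.sum_nonneg fun y _ => by
      split_ifs
      exacts [(edgeProb_pos hθ.2.2.2 _ _).le, le_rfl]
  rw [Measure.real, law, Measure.bind_apply (Set.toFinite E).measurableSet
    (measurable_of_finite _).aemeasurable, lintegral_fintype]
  simp_rw [labelsLaw_singleton hθ, condLaw_apply hθ]
  rw [ENNReal.toReal_sum (by finiteness)]
  refine Finset.sum_congr rfl fun z _ => ?_
  rw [ENNReal.toReal_mul, ENNReal.toReal_ofReal (h0 z),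
    ENNReal.toReal_ofReal (labelProb_pos hθ.1 z).le, mul_comm]

lemma sum_edgeProb (H : Matrix (Fin K) (Fin K) ℝ) (z : Fin n → Fin K) :
    ∑ y, edgeProb H z y = 1 := by
  have := Finset.prod_univ_sum (fun _ : Pair n => (Finset.univ : Finset Bool))
    (fun e b => if b then H (z e.1.1) (z e.1.2) else 1 - H (z e.1.1) (z e.1.2))
  simp only [Fintype.piFinset_univ] at this
  unfold edgeProb
  rw [← this]
  simp

lemma sum_labelProb (w : Fin K → ℝ) :
    ∑ z : Fin n → Fin K, labelProb w z = (∑ a, w a) ^ n := by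
  have := Finset.prod_univ_sum (fun _ : Fin n => (Finset.univ : Finset (Fin K))) (fun _ a => w a)
  simp only [Fintype.piFinset_univ] at this
  unfold labelProb
  rw [← this]
  simp

open Classical in
lemma law_real_compl {θ : Param K} (hθ : θ ∈ Theta K) (E : Set (SimpleGraph (Fin n))) :
    (law n θ).real E = 1 - (law n θ).real Eᶜ := by
  have h1 : (1 : ℝ) = ∑ z : Fin n → Fin K, labelProb θ.prop z := by
    rw [sum_labelProb, hθ.2.1, one_pow]
  rw [law_real_apply hθ, law_real_apply hθ, eq_sub_iff_add_eq, ← Finset.sum_add_distrib, h1]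
  refine Finset.sum_congr rfl fun z _ => ?_
  rw [← mul_add, ← Finset.sum_add_distrib]
  conv_rhs => rw [← mul_one (labelProb _ _), ← sum_edgeProb θ.conn z]
  congr 1
  refine Finset.sum_congr rfl fun y _ => ?_
  by_cases h : graphOf y ∈ E <;> simp [h]

lemma graphOf_adj (y : Pair n → Bool) (e : Pair n) :
    (graphOf y).Adj e.1.1 e.1.2 ↔ y e = true := by
  obtain ⟨⟨i, j⟩, h⟩ := e
  simp only [graphOf, SimpleGraph.fromRel_adj]
  constructor
  · rintro ⟨_, ⟨h', h2⟩ | ⟨h', h2⟩⟩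
    · exact h2
    · exact absurd h (not_lt.2 (le_of_lt h'))
  · intro h2
    exact ⟨ne_of_lt h, Or.inl ⟨h, h2⟩⟩

lemma prod_pow_nodeCount (p : Fin K → ℝ) (z : Fin n → Fin K) :
    ∏ a, p a ^ nodeCount z a = labelProb p z := by
  simp only [nodeCount, ← Finset.prod_pow_eq_pow_sum, labelProb]
  rw [Finset.prod_comm]
  refine Finset.prod_congr rfl fun i _ => ?_
  simp [pow_ite]

/-- A product over ordered pairs of distinct nodes as a product over unordered pairs. -/
@[to_additive]
lemma prod_offDiag_eq_prod_pair {M : Type*} [CommMonoid M] (w : Fin n → Fin n → M) :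
    (∏ i, ∏ j, if j ≠ i then w i j else 1) = ∏ e : Pair n, w e.1.1 e.1.2 * w e.1.2 e.1.1 := by
  have h2 : ∀ v : Fin n → Fin n → M,
      ∏ e : Pair n, v e.1.1 e.1.2 = ∏ i, ∏ j, if i < j then v i j else 1 := by
    intro v
    rw [← Finset.prod_product' (f := fun i j => if i < j then v i j else 1), Finset.univ_product_univ,
      ← Finset.prod_filter, ← Finset.prod_subtype_eq_prod_filter]
    simp
  rw [Finset.prod_mul_distrib, h2, h2 (fun i j => w j i), Finset.prod_comm (f := fun i j => if i < j then w j i else 1),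
    ← Finset.prod_mul_distrib]
  refine Finset.prod_congr rfl fun i _ => ?_
  rw [← Finset.prod_mul_distrib]
  refine Finset.prod_congr rfl fun j _ => ?_
  rcases lt_trichotomy i j with h | h | h
  · simp [h, h.ne', h.not_gt]
  · simp [h]
  · simp [h, h.ne, h.not_gt]

open Classical in
lemma prod_conn_pow (H : Matrix (Fin K) (Fin K) ℝ) (G : SimpleGraph (Fin n))
    (z : Fin n → Fin K) :
    ∏ a, ∏ b, H a b ^ edgeCount G z a b * (1 - H a b) ^ (pairCount z a b - edgeCount G z a b)
      = ∏ i, ∏ j, if j ≠ i then (if G.Adj i j then H (z i) (z j) else 1 - H (z i) (z j)) else 1 := by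
  have h1 : ∀ a b, pairCount z a b - edgeCount G z a b
      = ∑ i, ∑ j, if j ≠ i ∧ z i = a ∧ z j = b then (if G.Adj i j then 0 else 1) else 0 := by
    intro a b
    apply Nat.sub_eq_of_eq_add
    simp only [pairCount, edgeCount, ← Finset.sum_add_distrib]
    refine Finset.sum_congr rfl fun i _ => Finset.sum_congr rfl fun j _ => ?_
    simp only [SimpleGraph.adjMatrix_apply]
    split_ifs <;> rfl
  have h2 : ∀ a b, H a b ^ edgeCount G z a b *
      (1 - H a b) ^ (pairCount z a b - edgeCount G z a b)
      = ∏ i, ∏ j, if z j = b then (if z i = a then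
        (if j ≠ i then (if G.Adj i j then H (z i) (z j) else 1 - H (z i) (z j)) else 1) else 1)
        else 1 := by
    intro a b
    rw [h1]
    simp only [edgeCount, ← Finset.prod_pow_eq_pow_sum]
    rw [← Finset.prod_mul_distrib]
    refine Finset.prod_congr rfl fun i _ => ?_
    rw [← Finset.prod_mul_distrib]
    refine Finset.prod_congr rfl fun j _ => ?_
    by_cases hb : z j = b
    · by_cases ha : z i = a
      · by_cases hij : j ≠ i <;> by_cases hG : G.Adj i j <;>
          simp [ha, hb, hij, hG, SimpleGraph.adjMatrix_apply]
      · simp [ha]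
    · simp [hb]
  simp only [h2]
  rw [Finset.prod_congr rfl fun a _ => Finset.prod_comm, Finset.prod_comm]
  refine Finset.prod_congr rfl fun i _ => ?_
  rw [Finset.prod_congr rfl fun a _ => Finset.prod_comm, Finset.prod_comm]
  refine Finset.prod_congr rfl fun j _ => ?_
  simp

lemma completeLikelihood_graphOf {θ : Param K} (hθ : θ ∈ Theta K) (z : Fin n → Fin K)
    (y : Pair n → Bool) :
    completeLikelihood z (graphOf y) θ = labelProb θ.prop z * edgeProb θ.conn z y := by
  classical
  rw [completeLikelihood, prod_pow_nodeCount, prod_conn_pow, prod_offDiag_eq_prod_pair]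
  congr 1
  rw [Real.sqrt_eq_iff_mul_self_eq_of_pos (edgeProb_pos hθ.2.2.2 _ _), edgeProb,
    ← Finset.prod_mul_distrib]
  refine Finset.prod_congr rfl fun e _ => ?_
  rw [SimpleGraph.adj_comm _ e.1.2 e.1.1, hθ.2.2.1.apply (z e.1.1) (z e.1.2)]
  simp only [graphOf_adj]

lemma likelihood_graphOf {θ : Param K} (hθ : θ ∈ Theta K) (y : Pair n → Bool) :
    likelihood (graphOf y) θ = ∑ z : Fin n → Fin K, labelProb θ.prop z * edgeProb θ.conn z y :=
  Finset.sum_congr rfl fun z _ => completeLikelihood_graphOf hθ z y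

end SBM

namespace SBM

variable {n K K' : ℕ}

open Classical in
/-- If every likelihood of a family depends on the data through a statistic `T` only, and its
Hellinger affinity with `P` is at most `A`, then under `P` it is unlikely that some member of the
family exceeds `c * P`; the supremum over the family costs the number of values of `T`. -/
lemma sum_exists_le_of_statistic {Y τ I : Type*} [Fintype Y] [Fintype τ] {P : Y → ℝ}
    (hP : ∀ y, 0 ≤ P y) {q : I → Y → ℝ} (T : Y → τ)
    (hT : ∀ h y y', T y = T y' → q h y = q h y') {A c : ℝ} (hA0 : 0 ≤ A) (hc : 0 < c)
    (hA : ∀ h, ∑ y, √(P y) * √(q h y) ≤ A) :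
    ∑ y, (if ∃ h, c * P y ≤ q h y then P y else 0) ≤ Fintype.card τ * (A / √c) := by
  have key : ∀ t : τ, ∑ y with T y = t, (if ∃ h, c * P y ≤ q h y then P y else 0) ≤ A / √c := by
    intro t
    rw [← Finset.sum_filter, Finset.filter_filter]
    set s := Finset.univ.filter fun y => T y = t ∧ ∃ h, c * P y ≤ q h y with hs
    rcases s.eq_empty_or_nonempty with he | hne
    · rw [he, Finset.sum_empty]
      positivity
    · obtain ⟨y₀, hy₀, hmax⟩ := s.exists_max_image P hne
      obtain ⟨hy₀t, h, hh⟩ := (Finset.mem_filter.1 hy₀).2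
      have hle : ∀ y ∈ s, P y ≤ √(P y) * √(q h y) / √c := by
        intro y hy
        have hyt := (Finset.mem_filter.1 hy).2.1
        have h1 : c * P y ≤ q h y := by
          rw [hT h y y₀ (hyt.trans hy₀t.symm)]
          exact (mul_le_mul_of_nonneg_left (hmax y hy) hc.le).trans hh
        have h2 : √c * √(P y) ≤ √(q h y) := by
          rw [← Real.sqrt_mul hc.le]
          exact Real.sqrt_le_sqrt h1
        rw [le_div_iff₀ (Real.sqrt_pos.2 hc)]
        calc P y * √c = √(P y) * (√c * √(P y)) := by
              nth_rw 1 [← Real.mul_self_sqrt (hP y)]; ring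
          _ ≤ _ := mul_le_mul_of_nonneg_left h2 (Real.sqrt_nonneg _)
      calc ∑ y ∈ s, P y ≤ ∑ y ∈ s, √(P y) * √(q h y) / √c := Finset.sum_le_sum hle
        _ ≤ ∑ y, √(P y) * √(q h y) / √c :=
            Finset.sum_le_univ_sum_of_nonneg fun y => by positivity
        _ ≤ A / √c := by
            rw [← Finset.sum_div]
            gcongr
            exact hA h
  calc _ = ∑ t, ∑ y with T y = t, (if ∃ h, c * P y ≤ q h y then P y else 0) :=
        (Finset.sum_fiberwise _ _ _).symm
    _ ≤ ∑ _t : τ, A / √c := Finset.sum_le_sum fun t _ => key t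
    _ = _ := by simp

lemma card_pair_le (n : ℕ) : Fintype.card (Pair n) ≤ n ^ 2 := by
  refine (Fintype.card_subtype_le _).trans ?_
  simp [sq]

/-- The numbers of edges between the blocks of `z`. -/
def edgeType (z : Fin n → Fin K) (y : Pair n → Bool) : Fin K × Fin K → Fin (n ^ 2 + 1) :=
  fun c => ⟨((Finset.univ.filter fun e : Pair n => (z e.1.1, z e.1.2) = c).filter
    fun e => y e = true).card, Nat.lt_succ_of_le <| (Finset.card_le_univ _).trans (card_pair_le n)⟩

lemma edgeProb_eq_of_edgeType_eq (H : Matrix (Fin K) (Fin K) ℝ) (z : Fin n → Fin K)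
    {y y' : Pair n → Bool} (h : edgeType z y = edgeType z y') :
    edgeProb H z y = edgeProb H z y' := by
  have key : ∀ x : Pair n → Bool, edgeProb H z x = ∏ c : Fin K × Fin K,
      (H c.1 c.2 ^ (edgeType z x c : ℕ) * (1 - H c.1 c.2) ^
        ((Finset.univ.filter fun e : Pair n => (z e.1.1, z e.1.2) = c).card - edgeType z x c)) := by
    intro x
    rw [edgeProb, ← Finset.prod_fiberwise Finset.univ (fun e : Pair n => (z e.1.1, z e.1.2))]
    refine Finset.prod_congr rfl fun c _ => ?_
    have h1 := Finset.card_filter_add_card_filter_not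
      (s := Finset.univ.filter fun e : Pair n => (z e.1.1, z e.1.2) = c) (fun e => x e = true)
    rw [Finset.prod_congr rfl (g := fun e => if x e = true then H c.1 c.2 else 1 - H c.1 c.2),
      Finset.prod_ite, Finset.prod_const, Finset.prod_const]
    · congr 2
      simp only [edgeType]
      omega
    · intro e he
      rw [← (Finset.mem_filter.1 he).2]
  rw [key, key, h]

lemma card_edgeType (n K : ℕ) :
    Fintype.card (Fin K × Fin K → Fin (n ^ 2 + 1)) = (n ^ 2 + 1) ^ (K ^ 2) := by
  simp [sq]

lemma labelProb_le_one {θ : Param K} (hθ : θ ∈ Theta K) (z : Fin n → Fin K) :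
    labelProb θ.prop z ≤ 1 := by
  refine Finset.prod_le_one (fun i _ => (hθ.1 _).le) fun i _ => ?_
  rw [← hθ.2.1]
  exact Finset.single_le_sum (fun a _ => (hθ.1 a).le) (Finset.mem_univ _)

open Classical in
/-- Conditionally on the labels `Z`, a bound on the probability that the likelihood of some
parameter in `Theta K'` exceeds `exp D` times the likelihood of the true parameter. -/
lemma sum_exists_likelihood_le {θ₀ : Param K} (hθ₀ : θ₀ ∈ Theta K) (hK' : 1 ≤ K') {r : ℝ}
    (hr0 : 0 < r) (hr : ∀ a, r ≤ θ₀.prop a) (Z : Fin n → Fin K) {A : ℝ} (hA0 : 0 ≤ A)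
    (hA : ∀ z : Fin n → Fin K', ∀ θ ∈ Theta K',
      ∑ y, √(edgeProb θ₀.conn Z y) * √(edgeProb θ.conn z y) ≤ A) (D : ℝ) :
    ∑ y : Pair n → Bool, (if ∃ θ ∈ Theta K',
        Real.exp D * likelihood (graphOf y) θ₀ ≤ likelihood (graphOf y) θ
        then edgeProb θ₀.conn Z y else 0)
      ≤ (K' : ℝ) ^ n * (((n ^ 2 + 1) ^ (K' ^ 2) : ℕ) *
        (A / √(Real.exp D * r ^ n / (K' : ℝ) ^ n))) := by
  set c : ℝ := Real.exp D * r ^ n / (K' : ℝ) ^ n with hc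
  have hK0 : (0 : ℝ) < (K' : ℝ) ^ n := by positivity
  have hc0 : 0 < c := by positivity
  have hP0 : ∀ y, 0 < edgeProb θ₀.conn Z y := edgeProb_pos hθ₀.2.2.2 Z
  have hsub : ∀ y : Pair n → Bool, (∃ θ ∈ Theta K',
      Real.exp D * likelihood (graphOf y) θ₀ ≤ likelihood (graphOf y) θ) →
      ∃ z : Fin n → Fin K', ∃ θ : Theta K',
        c * edgeProb θ₀.conn Z y ≤ edgeProb θ.1.conn z y := by
    rintro y ⟨θ, hθ, hle⟩
    by_contra! hcon
    have hne : (Finset.univ : Finset (Fin n → Fin K')).Nonempty :=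
      ⟨fun _ => ⟨0, hK'⟩, Finset.mem_univ _⟩
    have h1 : likelihood (graphOf y) θ
        < ∑ _z : Fin n → Fin K', c * edgeProb θ₀.conn Z y := by
      rw [likelihood_graphOf hθ]
      refine Finset.sum_lt_sum_of_nonempty hne fun z _ => ?_
      exact (mul_le_of_le_one_left (edgeProb_pos hθ.2.2.2 z y).le (labelProb_le_one hθ z)).trans_lt
        (hcon z ⟨θ, hθ⟩)
    have h2 : r ^ n * edgeProb θ₀.conn Z y ≤ likelihood (graphOf y) θ₀ := by
      rw [likelihood_graphOf hθ₀]
      refine le_trans ?_ (Finset.single_le_sum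
        (f := fun z => labelProb θ₀.prop z * edgeProb θ₀.conn z y)
        (fun z _ => mul_nonneg (labelProb_pos hθ₀.1 z).le
          (edgeProb_pos hθ₀.2.2.2 z y).le) (Finset.mem_univ Z))
      refine mul_le_mul_of_nonneg_right ?_ (hP0 y).le
      calc r ^ n = ∏ _i : Fin n, r := by simp
        _ ≤ _ := Finset.prod_le_prod (fun _ _ => hr0.le) fun i _ => hr _
    have h3 : ∑ _z : Fin n → Fin K', c * edgeProb θ₀.conn Z y
        = Real.exp D * (r ^ n * edgeProb θ₀.conn Z y) := by
      simp only [Finset.sum_const, Finset.card_univ, Fintype.card_fun, Fintype.card_fin,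
        nsmul_eq_mul, Nat.cast_pow, hc]
      field_simp
    have h4 := mul_le_mul_of_nonneg_left h2 (Real.exp_pos D).le
    linarith
  calc _ ≤ ∑ y : Pair n → Bool, ∑ z : Fin n → Fin K', (if ∃ θ : Theta K',
        c * edgeProb θ₀.conn Z y ≤ edgeProb θ.1.conn z y then edgeProb θ₀.conn Z y else 0) := by
        refine Finset.sum_le_sum fun y _ => ?_
        have hnn : ∀ z ∈ (Finset.univ : Finset (Fin n → Fin K')), 0 ≤ (if ∃ θ : Theta K',
            c * edgeProb θ₀.conn Z y ≤ edgeProb θ.1.conn z y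
            then edgeProb θ₀.conn Z y else 0) := fun z _ => by
          split_ifs
          exacts [(hP0 y).le, le_rfl]
        by_cases h : ∃ θ ∈ Theta K',
            Real.exp D * likelihood (graphOf y) θ₀ ≤ likelihood (graphOf y) θ
        · rw [if_pos h]
          obtain ⟨z, hz⟩ := hsub y h
          refine le_trans ?_ (Finset.single_le_sum hnn (Finset.mem_univ z))
          rw [if_pos hz]
        · rw [if_neg h]
          exact Finset.sum_nonneg hnn
    _ = ∑ z : Fin n → Fin K', ∑ y : Pair n → Bool, (if ∃ θ : Theta K',
        c * edgeProb θ₀.conn Z y ≤ edgeProb θ.1.conn z y then edgeProb θ₀.conn Z y else 0) :=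
        Finset.sum_comm
    _ ≤ ∑ _z : Fin n → Fin K', (((n ^ 2 + 1) ^ (K' ^ 2) : ℕ) * (A / √c)) := by
        refine Finset.sum_le_sum fun z _ => ?_
        have := sum_exists_le_of_statistic (I := Theta K') (fun y => (hP0 y).le)
          (q := fun θ y => edgeProb θ.1.conn z y) (edgeType z)
          (fun θ y y' h => edgeProb_eq_of_edgeType_eq _ z h) hA0 hc0 (fun θ => hA z θ.1 θ.2)
        rwa [card_edgeType] at this
    _ = _ := by simp

/-- The Hellinger affinity of two edge laws. -/
lemma sum_sqrt_edgeProb_le {H : Matrix (Fin K) (Fin K) ℝ} (hH : ∀ a b, H a b ∈ Set.Ioo (0 : ℝ) 1)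
    {H' : Matrix (Fin K') (Fin K') ℝ} (hH' : ∀ a b, H' a b ∈ Set.Ioo (0 : ℝ) 1)
    (Z : Fin n → Fin K) (z : Fin n → Fin K') :
    ∑ y, √(edgeProb H Z y) * √(edgeProb H' z y) ≤
      Real.exp (-(1 / 2) * ∑ e : Pair n,
        (√(H (Z e.1.1) (Z e.1.2)) - √(H' (z e.1.1) (z e.1.2))) ^ 2) := by
  have h1 : ∀ y, √(edgeProb H Z y) * √(edgeProb H' z y) = ∏ e : Pair n,
      if y e then √(H (Z e.1.1) (Z e.1.2)) * √(H' (z e.1.1) (z e.1.2))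
      else √(1 - H (Z e.1.1) (Z e.1.2)) * √(1 - H' (z e.1.1) (z e.1.2)) := by
    intro y
    rw [edgeProb, edgeProb, Real.sqrt_prod, Real.sqrt_prod, ← Finset.prod_mul_distrib]
    · exact Finset.prod_congr rfl fun e _ => by split_ifs <;> rfl
    · intro e _
      have := hH' (z e.1.1) (z e.1.2)
      split_ifs <;> linarith [this.1, this.2]
    · intro e _
      have := hH (Z e.1.1) (Z e.1.2)
      split_ifs <;> linarith [this.1, this.2]
  have h2 := Finset.prod_univ_sum (fun _ : Pair n => (Finset.univ : Finset Bool))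
    (fun e b => if b then √(H (Z e.1.1) (Z e.1.2)) * √(H' (z e.1.1) (z e.1.2))
      else √(1 - H (Z e.1.1) (Z e.1.2)) * √(1 - H' (z e.1.1) (z e.1.2)))
  simp only [Fintype.piFinset_univ] at h2
  simp only [h1]
  rw [← h2, Finset.mul_sum, Real.exp_sum]
  refine Finset.prod_le_prod (fun e _ => Finset.sum_nonneg fun b _ => ?_) fun e _ => ?_
  · split_ifs <;> positivity
  · obtain ⟨ha, hb⟩ := hH (Z e.1.1) (Z e.1.2)
    obtain ⟨ha', hb'⟩ := hH' (z e.1.1) (z e.1.2)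
    simp only [Fintype.sum_bool, if_true, Bool.false_eq_true, if_false]
    refine le_trans ?_ (Real.add_one_le_exp _)
    have s1 := Real.sq_sqrt ha.le
    have s2 := Real.sq_sqrt ha'.le
    have s3 := Real.sq_sqrt (sub_nonneg.2 hb.le)
    have s4 := Real.sq_sqrt (sub_nonneg.2 hb'.le)
    nlinarith [sq_nonneg (√(1 - H (Z e.1.1) (Z e.1.2)) - √(1 - H' (z e.1.1) (z e.1.2)))]

end SBM

namespace SBM

variable {n K K' : ℕ}

open Classical in
/-- A lower-tail bound for the number of nodes with a given label. -/
lemma sum_labelProb_card_lt_le {p : Fin K → ℝ} (hp : ∀ a, 0 < p a) (hp1 : ∑ a, p a = 1)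
    (a : Fin K) :
    ∑ Z : Fin n → Fin K, (if ((Finset.univ.filter fun i => Z i = a).card : ℝ) < p a * n / 2
      then labelProb p Z else 0) ≤ Real.exp (-(p a * (1 / 2 - Real.exp (-1)) * n)) := by
  set w : Fin K → ℝ := fun b => p b * Real.exp (if b = a then -1 else 0) with hw
  have h1 : ∀ Z : Fin n → Fin K, labelProb w Z
      = labelProb p Z * Real.exp (-((Finset.univ.filter fun i => Z i = a).card : ℝ)) := by
    intro Z
    simp only [labelProb, hw]
    rw [Finset.prod_mul_distrib, ← Real.exp_sum]
    congr 2
    simp [Finset.sum_ite]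
  have h2 : ∑ b, w b ≤ Real.exp (-(p a * (1 - Real.exp (-1)))) := by
    have h3 : ∑ b, w b = 1 - p a * (1 - Real.exp (-1)) := by
      have h5 := hp1
      rw [← Finset.add_sum_erase _ p (Finset.mem_univ a)] at h5
      rw [← Finset.add_sum_erase _ w (Finset.mem_univ a)]
      have h4 : ∑ b ∈ Finset.univ.erase a, w b = ∑ b ∈ Finset.univ.erase a, p b :=
        Finset.sum_congr rfl fun b hb => by simp [hw, Finset.ne_of_mem_erase hb]
      rw [h4]
      simp only [hw, if_true]
      linarith
    rw [h3]
    linarith [Real.add_one_le_exp (-(p a * (1 - Real.exp (-1))))]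
  calc _ ≤ ∑ Z : Fin n → Fin K, Real.exp (p a * n / 2) * labelProb w Z := by
        refine Finset.sum_le_sum fun Z _ => ?_
        rw [h1]
        have h0 := (labelProb_pos hp Z).le
        split_ifs with h
        · rw [mul_left_comm, ← Real.exp_add]
          refine le_mul_of_one_le_right h0 (Real.one_le_exp ?_)
          linarith
        · positivity
    _ = Real.exp (p a * n / 2) * (∑ b, w b) ^ n := by rw [← Finset.mul_sum, sum_labelProb]
    _ ≤ Real.exp (p a * n / 2) * Real.exp (-(p a * (1 - Real.exp (-1)))) ^ n := by
        gcongr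
        exact Finset.sum_nonneg fun b _ => mul_nonneg (hp b).le (Real.exp_pos _).le
    _ = _ := by
        rw [← Real.exp_nat_mul, ← Real.exp_add]
        congr 1
        ring

/-- When a labelling with fewer than `K` labels is compared with one of `K` large classes, two
classes are merged on a large part, which makes the connection probabilities differ on a number
of pairs of order `n ^ 2`. -/
lemma le_sum_sq_sub_of_lt (hK : K' < K) {H : Matrix (Fin K) (Fin K) ℝ} (hH : H.IsSymm)
    {H' : Matrix (Fin K') (Fin K') ℝ} (hH' : H'.IsSymm) (Z : Fin n → Fin K) (z : Fin n → Fin K')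
    {η Δ : ℝ} (hη : 2 ≤ η * n) (hΔ : 0 ≤ Δ)
    (hZ : ∀ a, K' * (η * n) ≤ ((Finset.univ.filter fun i => Z i = a).card : ℝ))
    (hsep : ∀ a b, a ≠ b → ∃ c, Δ ≤ (√(H c a) - √(H c b)) ^ 2) :
    (η * n) ^ 2 * Δ / 8 ≤
      ∑ e : Pair n, (√(H (Z e.1.1) (Z e.1.2)) - √(H' (z e.1.1) (z e.1.2))) ^ 2 := by
  set U : Fin K → Fin K' → Finset (Fin n) :=
    fun a m => Finset.univ.filter fun i => Z i = a ∧ z i = m with hU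
  have hn : 0 < n := by
    rcases Nat.eq_zero_or_pos n with h | h
    · subst h; norm_num at hη
    · exact h
  have hmaj : ∀ a, ∃ m, η * n ≤ ((U a m).card : ℝ) := by
    intro a
    by_contra! hcon
    have h1 : ((Finset.univ.filter fun i => Z i = a).card : ℝ) = ∑ m, ((U a m).card : ℝ) := by
      rw [Finset.card_eq_sum_card_fiberwise (f := z) (t := Finset.univ) (fun _ _ => by simp)]
      push_cast
      simp [hU, Finset.filter_filter]
    have h2 : ∑ m, ((U a m).card : ℝ) < ∑ _m : Fin K', η * n :=
      Finset.sum_lt_sum_of_nonempty ⟨z ⟨0, hn⟩, Finset.mem_univ _⟩ fun m _ => hcon m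
    have h3 := hZ a
    simp only [Finset.sum_const, Finset.card_univ, Fintype.card_fin, nsmul_eq_mul] at h2
    linarith
  choose m hm using hmaj
  obtain ⟨a, b, hab, hmab⟩ := Fintype.exists_ne_map_eq_of_card_lt m (by simpa using hK)
  obtain ⟨c, hc⟩ := hsep a b hab
  set d : Fin n → Fin n → ℝ := fun i j => (√(H (Z i) (Z j)) - √(H' (z i) (z j))) ^ 2 with hd
  have hd0 : ∀ i j, 0 ≤ d i j := fun i j => sq_nonneg _
  set h := H' (m c) (m a) with hh
  set α := (√(H c a) - √h) ^ 2 with hα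
  set β := (√(H c b) - √h) ^ 2 with hβ
  have hαβ : Δ / 2 ≤ α + β := by
    have : (√(H c a) - √(H c b)) ^ 2 ≤ 2 * (α + β) := by
      rw [hα, hβ]
      nlinarith [sq_nonneg ((√(H c a) - √h) + (√(H c b) - √h))]
    linarith
  have hrow : ∀ i ∈ U c (m c), (η * n - 1) * (α + β) ≤ ∑ j, if j ≠ i then d i j else 0 := by
    intro i hi
    obtain ⟨hi1, hi2⟩ := (Finset.mem_filter.1 hi).2
    have hblock : ∀ a', m a' = m a → (η * n - 1) * (√(H c a') - √h) ^ 2 ≤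
        ∑ j ∈ (U a' (m a')), if j ≠ i then d i j else 0 := by
      intro a' ha'
      have h1 : ∑ j ∈ (U a' (m a')).erase i, (if j ≠ i then d i j else 0)
          = ((U a' (m a')).erase i).card * (√(H c a') - √h) ^ 2 := by
        rw [← nsmul_eq_mul, ← Finset.sum_const]
        refine Finset.sum_congr rfl fun j hj => ?_
        obtain ⟨hj1, hj2⟩ := Finset.mem_erase.1 hj
        obtain ⟨hj3, hj4⟩ := (Finset.mem_filter.1 hj2).2
        simp only [hj1, ne_eq, not_false_eq_true, if_true, hd, hi1, hi2, hj3, hj4, ha', hh]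
      have h2 : ((U a' (m a')).card : ℝ) - 1 ≤ ((U a' (m a')).erase i).card := by
        have := Finset.pred_card_le_card_erase (s := U a' (m a')) (a := i)
        have h3 : (U a' (m a')).card ≤ ((U a' (m a')).erase i).card + 1 := by omega
        have h4 : ((U a' (m a')).card : ℝ) ≤ ((U a' (m a')).erase i).card + 1 := by exact_mod_cast h3
        linarith
      calc (η * n - 1) * (√(H c a') - √h) ^ 2
          ≤ ((U a' (m a')).erase i).card * (√(H c a') - √h) ^ 2 :=
            mul_le_mul_of_nonneg_right (by linarith [hm a']) (sq_nonneg _)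
        _ = _ := h1.symm
        _ ≤ _ := Finset.sum_le_sum_of_subset_of_nonneg (Finset.erase_subset _ _) fun j _ _ => by
            split_ifs
            exacts [hd0 _ _, le_rfl]
    have hdisj : Disjoint (U a (m a)) (U b (m b)) := by
      rw [Finset.disjoint_left]
      intro j hj hj'
      exact hab ((Finset.mem_filter.1 hj).2.1.symm.trans (Finset.mem_filter.1 hj').2.1)
    calc (η * n - 1) * (α + β) = (η * n - 1) * α + (η * n - 1) * β := by ring
      _ ≤ _ := add_le_add (hblock a rfl) (hblock b hmab.symm)
      _ = ∑ j ∈ U a (m a) ∪ U b (m b), if j ≠ i then d i j else 0 :=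
          (Finset.sum_union hdisj).symm
      _ ≤ _ := Finset.sum_le_univ_sum_of_nonneg fun j => by
          split_ifs
          exacts [hd0 _ _, le_rfl]
  have htot : (η * n) * ((η * n - 1) * (α + β)) ≤ ∑ i, ∑ j, if j ≠ i then d i j else 0 := by
    have hα0 : 0 ≤ (η * n - 1) * (α + β) :=
      mul_nonneg (by linarith) (add_nonneg (sq_nonneg _) (sq_nonneg _))
    calc _ ≤ ((U c (m c)).card : ℝ) * ((η * n - 1) * (α + β)) :=
          mul_le_mul_of_nonneg_right (hm c) hα0
      _ = ∑ _i ∈ U c (m c), (η * n - 1) * (α + β) := by simp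
      _ ≤ ∑ i ∈ U c (m c), ∑ j, (if j ≠ i then d i j else 0) := Finset.sum_le_sum hrow
      _ ≤ _ := Finset.sum_le_univ_sum_of_nonneg fun i => Finset.sum_nonneg fun j _ => by
          split_ifs
          exacts [hd0 _ _, le_rfl]
  have hsymm : ∀ i j, d j i = d i j := fun i j => by
    simp only [hd]
    rw [hH.apply (Z i) (Z j), hH'.apply (z i) (z j)]
  rw [sum_offDiag_eq_sum_pair] at htot
  rw [Finset.sum_congr rfl fun e _ => (by rw [hsymm, ← two_mul] :
    d e.1.1 e.1.2 + d e.1.2 e.1.1 = 2 * d e.1.1 e.1.2), ← Finset.mul_sum] at htot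
  have hfin : (η * n) ^ 2 * Δ / 4 ≤ (η * n) * ((η * n - 1) * (α + β)) := by
    have h1 : η * n / 2 * (Δ / 2) ≤ (η * n - 1) * (α + β) :=
      mul_le_mul (by linarith) hαβ (by positivity) (by linarith)
    calc (η * n) ^ 2 * Δ / 4 = (η * n) * (η * n / 2 * (Δ / 2)) := by ring
      _ ≤ _ := mul_le_mul_of_nonneg_left h1 (by linarith)
  have h9 := hfin.trans htot
  change _ ≤ ∑ e : Pair n, d e.1.1 e.1.2
  linarith

lemma likelihood_graphOf_le_one {θ : Param K} (hθ : θ ∈ Theta K) (y : Pair n → Bool) :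
    likelihood (graphOf y) θ ≤ 1 := by
  rw [likelihood_graphOf hθ]
  calc _ ≤ ∑ z : Fin n → Fin K, labelProb θ.prop z := by
        refine Finset.sum_le_sum fun z _ => ?_
        refine mul_le_of_le_one_right (labelProb_pos hθ.1 z).le ?_
        rw [← sum_edgeProb θ.conn z]
        exact Finset.single_le_sum (fun y _ => (edgeProb_pos hθ.2.2.2 z y).le) (Finset.mem_univ y)
    _ = 1 := by rw [sum_labelProb, hθ.2.1, one_pow]

lemma likelihood_graphOf_pos (hK : 1 ≤ K) {θ : Param K} (hθ : θ ∈ Theta K) (y : Pair n → Bool) :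
    0 < likelihood (graphOf y) θ := by
  rw [likelihood_graphOf hθ]
  exact Finset.sum_pos (fun z _ => mul_pos (labelProb_pos hθ.1 z) (edgeProb_pos hθ.2.2.2 z y))
    ⟨fun _ => ⟨0, hK⟩, Finset.mem_univ _⟩

lemma nonempty_theta (hK : 1 ≤ K) : (Theta K).Nonempty := by
  have h : (0 : ℝ) < K := by exact_mod_cast hK
  refine ⟨⟨fun _ => (K : ℝ)⁻¹, Matrix.of fun _ _ => 1 / 2⟩, fun a => by positivity, ?_, ?_, ?_⟩
  · simp [h.ne']
  · ext; rfl
  · intro a b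
    simp only [Matrix.of_apply]
    norm_num

lemma exists_likelihood_ge_of_not_criterion_lt {N : ℕ → ℝ} {B : ℝ} {θ₀ : Param K}
    (hθ₀ : θ₀ ∈ Theta K) (hK : 1 ≤ K) (hK' : 1 ≤ K') (y : Pair n → Bool)
    (h : ¬ criterion N B (graphOf y) K' < criterion N B (graphOf y) K) :
    ∃ θ ∈ Theta K', Real.exp ((N K' - N K) * B - 1) * likelihood (graphOf y) θ₀
      ≤ likelihood (graphOf y) θ := by
  have hbdd : BddAbove ((fun θ : Param K => Real.log (likelihood (graphOf y) θ)) '' Theta K) := by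
    refine ⟨0, ?_⟩
    rintro _ ⟨θ, hθ, rfl⟩
    exact Real.log_nonpos (likelihood_graphOf_pos hK hθ y).le (likelihood_graphOf_le_one hθ y)
  have h1 : Real.log (likelihood (graphOf y) θ₀) ≤ maxLogLikelihood K (graphOf y) :=
    le_csSup hbdd ⟨θ₀, hθ₀, rfl⟩
  obtain ⟨_, ⟨θ, hθ, rfl⟩, h2⟩ := exists_lt_of_lt_csSup ((nonempty_theta hK').image
    (fun θ : Param K' => Real.log (likelihood (graphOf y) θ)))
    (sub_one_lt (maxLogLikelihood K' (graphOf y)))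
  refine ⟨θ, hθ, ?_⟩
  simp only [criterion, not_lt] at h
  rw [← Real.log_le_log_iff (mul_pos (Real.exp_pos _) (likelihood_graphOf_pos hK hθ₀ y))
    (likelihood_graphOf_pos hK' hθ y), Real.log_mul (Real.exp_pos _).ne'
    (likelihood_graphOf_pos hK hθ₀ y).ne', Real.log_exp]
  simp only at h2
  linarith

end SBM

namespace SBM

variable {n K K' : ℕ}

lemma types_bound_le_exp (n : ℕ) {K' : ℕ} (hK' : 1 ≤ K') {r : ℝ} (hr0 : 0 < r) (D α : ℝ) :
    (K' : ℝ) ^ n * (((n ^ 2 + 1) ^ (K' ^ 2) : ℕ) *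
        (Real.exp (-α) / √(Real.exp D * r ^ n / (K' : ℝ) ^ n)))
      ≤ Real.exp ((Real.log K' + 2 * K' ^ 2 + (Real.log K' - Real.log r) / 2) * n - D / 2 - α) := by
  have hK0 : (0 : ℝ) < K' := by exact_mod_cast hK'
  have h1 : (K' : ℝ) ^ n = Real.exp (Real.log K' * n) := by
    rw [mul_comm, Real.exp_nat_mul, Real.exp_log hK0]
  have h2 : r ^ n = Real.exp (Real.log r * n) := by
    rw [mul_comm, Real.exp_nat_mul, Real.exp_log hr0]
  have h3 : (((n ^ 2 + 1) ^ (K' ^ 2) : ℕ) : ℝ) ≤ Real.exp (2 * K' ^ 2 * n) := by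
    have h4 : ((n : ℝ) ^ 2 + 1) ≤ Real.exp (2 * n) := by
      have := Real.add_one_le_exp (n : ℝ)
      have hn : (0 : ℝ) ≤ n := n.cast_nonneg
      rw [show (2 : ℝ) * n = n + n by ring, Real.exp_add]
      nlinarith
    push_cast
    calc ((n : ℝ) ^ 2 + 1) ^ (K' ^ 2) ≤ Real.exp (2 * n) ^ (K' ^ 2) := by gcongr
      _ = _ := by
        rw [← Real.exp_nat_mul]
        push_cast
        ring_nf
  rw [h1, h2, ← Real.exp_add, ← Real.exp_sub, Real.sqrt_eq_rpow, ← Real.exp_mul, ← Real.exp_sub]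
  calc _ ≤ Real.exp (Real.log K' * n) * (Real.exp (2 * K' ^ 2 * n) *
        Real.exp (-α - (D + Real.log r * n - Real.log K' * n) * (1 / 2))) := by gcongr
    _ = _ := by
      rw [← Real.exp_add, ← Real.exp_add]
      congr 1
      ring

open Classical in
/-- The probability that the true number `K` of blocks beats `K'` is bounded below in terms of
the Hellinger affinity of the edge laws, uniformly over a set of good true labels. -/
lemma le_law_criterion_lt {θ₀ : Param K} (hθ₀ : θ₀ ∈ Theta K) (hK : 1 ≤ K) (hK' : 1 ≤ K')
    (N : ℕ → ℝ) (B : ℝ) {r : ℝ} (hr0 : 0 < r) (hr : ∀ a, r ≤ θ₀.prop a) (α : ℝ)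
    (good : Set (Fin n → Fin K))
    (hgood : ∀ Z ∈ good, ∀ z : Fin n → Fin K', ∀ θ ∈ Theta K', 2 * α ≤ ∑ e : Pair n,
      (√(θ₀.conn (Z e.1.1) (Z e.1.2)) - √(θ.conn (z e.1.1) (z e.1.2))) ^ 2) :
    1 - (∑ Z : Fin n → Fin K, if Z ∈ good then 0 else labelProb θ₀.prop Z)
      - Real.exp ((Real.log K' + 2 * K' ^ 2 + (Real.log K' - Real.log r) / 2) * n
        - ((N K' - N K) * B - 1) / 2 - α)
      ≤ (law n θ₀).real {G | criterion N B G K' < criterion N B G K} := by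
  set b := Real.exp ((Real.log K' + 2 * K' ^ 2 + (Real.log K' - Real.log r) / 2) * n
        - ((N K' - N K) * B - 1) / 2 - α) with hb
  have hE := fun Z : Fin n → Fin K => edgeProb_pos hθ₀.2.2.2 Z
  obtain ⟨F, hF⟩ : ∃ F, F = {G : SimpleGraph (Fin n) |
    criterion N B G K' < criterion N B G K}ᶜ := ⟨_, rfl⟩
  have hmem : ∀ y, graphOf y ∈ F → ¬ criterion N B (graphOf y) K' < criterion N B (graphOf y) K := by
    intro y hy
    rwa [hF] at hy
  rw [law_real_compl hθ₀, ← hF, law_real_apply hθ₀]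
  have hcond : ∀ Z : Fin n → Fin K, (∑ y : Pair n → Bool,
      if graphOf y ∈ F then edgeProb θ₀.conn Z y else 0) ≤ (if Z ∈ good then 0 else 1) + b := by
    intro Z
    by_cases hZ : Z ∈ good
    · rw [if_pos hZ, zero_add]
      refine le_trans ?_ ((sum_exists_likelihood_le hθ₀ hK' hr0 hr Z (Real.exp_pos (-α)).le
        (fun z θ hθ => ?_) ((N K' - N K) * B - 1)).trans (types_bound_le_exp n hK' hr0 _ _))
      · refine Finset.sum_le_sum fun y _ => ?_
        split_ifs with h1 h2 h2
        · exact le_rfl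
        · exact absurd (exists_likelihood_ge_of_not_criterion_lt hθ₀ hK hK' y (hmem y h1)) h2
        · exact (hE Z y).le
        · exact le_rfl
      · refine (sum_sqrt_edgeProb_le hθ₀.2.2.2 hθ.2.2.2 Z z).trans (Real.exp_le_exp.2 ?_)
        linarith [hgood Z hZ z θ hθ]
    · rw [if_neg hZ]
      calc _ ≤ ∑ y, edgeProb θ₀.conn Z y := Finset.sum_le_sum fun y _ => by
            split_ifs
            exacts [le_rfl, (hE Z y).le]
        _ = 1 := sum_edgeProb _ _
        _ ≤ 1 + b := by linarith [Real.exp_pos ((Real.log K' + 2 * K' ^ 2 +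
            (Real.log K' - Real.log r) / 2) * n - ((N K' - N K) * B - 1) / 2 - α)]
  have hle : ∑ Z : Fin n → Fin K, labelProb θ₀.prop Z * (∑ y : Pair n → Bool,
      if graphOf y ∈ F then edgeProb θ₀.conn Z y else 0) ≤
      (∑ Z : Fin n → Fin K, if Z ∈ good then 0 else labelProb θ₀.prop Z) + b := by
    calc _ ≤ ∑ Z : Fin n → Fin K, labelProb θ₀.prop Z * ((if Z ∈ good then 0 else 1) + b) :=
          Finset.sum_le_sum fun Z _ =>
            mul_le_mul_of_nonneg_left (hcond Z) (labelProb_pos hθ₀.1 Z).le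
      _ = _ := by
        simp only [mul_add, Finset.sum_add_distrib, ← Finset.sum_mul, sum_labelProb, hθ₀.2.1,
          one_pow, one_mul, mul_ite, mul_zero, mul_one]
  linarith

lemma law_real_le_one {θ : Param K} (hθ : θ ∈ Theta K) (E : Set (SimpleGraph (Fin n))) :
    (law n θ).real E ≤ 1 := by
  rw [law_real_compl hθ]
  linarith [measureReal_nonneg (μ := law n θ) (s := Eᶜ)]

lemma exists_pos_forall_le {ι : Type*} [Finite ι] {f : ι → ℝ} (hf : ∀ i, 0 < f i) :
    ∃ r, 0 < r ∧ ∀ i, r ≤ f i := by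
  rcases isEmpty_or_nonempty ι with h | h
  · exact ⟨1, one_pos, fun i => h.elim i⟩
  · obtain ⟨i, hi⟩ := Finite.exists_min f
    exact ⟨f i, hf i, hi⟩

section Asymptotics

variable {ρ : ℕ → ℝ}

lemma tendsto_mul_of_div_log (hρ_pos : ∀ n, 0 < ρ n)
    (hρ : Tendsto (fun n : ℕ => (n : ℝ) * ρ n / Real.log n) atTop atTop) :
    Tendsto (fun n : ℕ => (n : ℝ) * ρ n) atTop atTop := by
  refine tendsto_atTop_mono' _ ?_ hρ
  have hlog := (Real.tendsto_log_atTop.comp tendsto_natCast_atTop_atTop).eventually_ge_atTop 1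
  filter_upwards [hlog] with n hn
  exact div_le_self (mul_nonneg n.cast_nonneg (hρ_pos n).le) hn

lemma tendsto_exponent_of_isLittleO (hρ_pos : ∀ n, 0 < ρ n)
    (hρ : Tendsto (fun n : ℕ => (n : ℝ) * ρ n) atTop atTop) {B : ℕ → ℝ}
    (hB : B =o[atTop] (fun n : ℕ => (n : ℝ) ^ 2 * ρ n)) (C δ : ℝ) {a : ℝ} (ha : 0 < a) :
    Tendsto (fun n : ℕ => C * n - (δ * B n - 1) / 2 - a * ((n : ℝ) ^ 2 * ρ n)) atTop atBot := by
  have h1 := hB.def (show 0 < a / (|δ| + 1) by positivity)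
  have h2 := hρ.eventually_ge_atTop ((C + 1) * (2 / a))
  have h3 : Tendsto (fun n : ℕ => 1 / 2 - (n : ℝ)) atTop atBot :=
    tendsto_atBot_add_const_left _ _ (tendsto_neg_atTop_atBot.comp tendsto_natCast_atTop_atTop)
  refine tendsto_atBot_mono' _ ?_ h3
  filter_upwards [h1, h2] with n hn1 hn2
  have hm : 0 ≤ (n : ℝ) ^ 2 * ρ n := mul_nonneg (sq_nonneg _) (hρ_pos n).le
  rw [Real.norm_eq_abs, Real.norm_eq_abs, abs_of_nonneg hm] at hn1
  have h4 : -(δ * B n) ≤ a * ((n : ℝ) ^ 2 * ρ n) := by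
    calc -(δ * B n) ≤ |δ * B n| := neg_le_abs _
      _ = |δ| * |B n| := abs_mul _ _
      _ ≤ (|δ| + 1) * (a / (|δ| + 1) * ((n : ℝ) ^ 2 * ρ n)) := by
        gcongr
        linarith
      _ = _ := by field_simp
  have h5 : (C + 1) * n ≤ a / 2 * ((n : ℝ) ^ 2 * ρ n) := by
    have h6 := mul_le_mul_of_nonneg_left hn2 (show 0 ≤ a / 2 * (n : ℝ) by positivity)
    calc (C + 1) * n = a / 2 * n * ((C + 1) * (2 / a)) := by field_simp
      _ ≤ _ := h6
      _ = _ := by ring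
  linarith

lemma tendsto_exponent_of_tendsto (hρ_pos : ∀ n, 0 < ρ n)
    (hρ : Tendsto (fun n : ℕ => (n : ℝ) * ρ n) atTop atTop) {B : ℕ → ℝ}
    (hB : Tendsto (fun n : ℕ => B n * (n : ℝ) ^ (-(3 / 2) : ℝ) * ρ n ^ (-(1 / 2) : ℝ)) atTop atTop)
    (C : ℝ) {δ : ℝ} (hδ : 0 < δ) :
    Tendsto (fun n : ℕ => C * n - (δ * B n - 1) / 2 - 0) atTop atBot := by
  have h1 := hB.eventually_ge_atTop (max 0 ((C + 1) * (2 / δ)))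
  have h2 := hρ.eventually_ge_atTop 1
  have h3 : Tendsto (fun n : ℕ => 1 / 2 - (n : ℝ)) atTop atBot :=
    tendsto_atBot_add_const_left _ _ (tendsto_neg_atTop_atBot.comp tendsto_natCast_atTop_atTop)
  refine tendsto_atBot_mono' _ ?_ h3
  filter_upwards [h1, h2, eventually_gt_atTop 0] with n hn1 hn2 hn0
  have hn : (0 : ℝ) < n := by exact_mod_cast hn0
  have h4 : (n : ℝ) ^ (-(3 / 2) : ℝ) * ρ n ^ (-(1 / 2) : ℝ)
      = (n : ℝ)⁻¹ * ((n : ℝ) * ρ n) ^ (-(1 / 2) : ℝ) := by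
    rw [Real.mul_rpow hn.le (hρ_pos n).le, ← mul_assoc, ← Real.rpow_neg_one, ← Real.rpow_add hn]
    norm_num
  have h5 : 0 < ((n : ℝ) * ρ n) ^ (-(1 / 2) : ℝ) :=
    Real.rpow_pos_of_pos (by linarith) _
  have h6 : ((n : ℝ) * ρ n) ^ (-(1 / 2) : ℝ) ≤ 1 :=
    Real.rpow_le_one_of_one_le_of_nonpos hn2 (by norm_num)
  rw [mul_assoc, h4, ← mul_assoc] at hn1
  have h7 : 0 ≤ B n * (n : ℝ)⁻¹ :=
    nonneg_of_mul_nonneg_left ((le_max_left _ _).trans hn1) h5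
  have h8 : (C + 1) * (2 / δ) ≤ B n * (n : ℝ)⁻¹ :=
    (le_max_right _ _).trans (hn1.trans (mul_le_of_le_one_right h7 h6))
  have h9 : (C + 1) * n ≤ δ / 2 * B n := by
    have h10 := mul_le_mul_of_nonneg_left h8 (show 0 ≤ δ / 2 * (n : ℝ) by positivity)
    calc (C + 1) * n = δ / 2 * n * ((C + 1) * (2 / δ)) := by field_simp
      _ ≤ _ := h10
      _ = _ := by field_simp
  linarith

end Asymptotics

/-- The label vectors in which every label occurs at least half as often as expected. -/
def balanced (p : Fin K → ℝ) (n : ℕ) : Set (Fin n → Fin K) :=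
  {Z | ∀ a, p a * n / 2 ≤ ((Finset.univ.filter fun i => Z i = a).card : ℝ)}

open Classical in
lemma tendsto_sum_labelProb_not_balanced {p : Fin K → ℝ} (hp : ∀ a, 0 < p a)
    (hp1 : ∑ a, p a = 1) :
    Tendsto (fun n : ℕ => ∑ Z : Fin n → Fin K,
      if Z ∈ balanced p n then 0 else labelProb p Z) atTop (𝓝 0) := by
  have hδ : 0 < 1 / 2 - Real.exp (-1) := by
    rw [Real.exp_neg]
    have h := Real.exp_one_gt_d9
    have : (Real.exp 1)⁻¹ < 2⁻¹ := inv_strictAnti₀ (by norm_num) (by linarith)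
    linarith
  have hlim : Tendsto (fun n : ℕ => ∑ a, Real.exp (-(p a * (1 / 2 - Real.exp (-1)) * n)))
      atTop (𝓝 0) := by
    suffices h : Tendsto (fun n : ℕ => ∑ a, Real.exp (-(p a * (1 / 2 - Real.exp (-1)) * n)))
        atTop (𝓝 (∑ _a : Fin K, 0)) by simpa using h
    refine tendsto_finsetSum _ fun a _ => Real.tendsto_exp_neg_atTop_nhds_zero.comp ?_
    exact tendsto_natCast_atTop_atTop.const_mul_atTop (mul_pos (hp a) hδ)
  refine squeeze_zero (fun n => Finset.sum_nonneg fun Z _ => ?_) (fun n => ?_) hlim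
  · split_ifs
    exacts [le_rfl, (labelProb_pos hp Z).le]
  · refine le_trans ?_ (Finset.sum_le_sum fun a _ => sum_labelProb_card_lt_le (n := n) hp hp1 a)
    rw [Finset.sum_comm]
    refine Finset.sum_le_sum fun Z _ => ?_
    have h0 : ∀ a ∈ (Finset.univ : Finset (Fin K)),
        0 ≤ (if ((Finset.univ.filter fun i => Z i = a).card : ℝ) < p a * n / 2
          then labelProb p Z else 0) := fun a _ => by
      split_ifs
      exacts [(labelProb_pos hp Z).le, le_rfl]
    split_ifs with h
    · exact Finset.sum_nonneg h0
    · simp only [balanced, Set.mem_ofPred_eq, not_forall, not_le] at h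
      obtain ⟨a, ha⟩ := h
      refine le_trans ?_ (Finset.single_le_sum h0 (Finset.mem_univ a))
      rw [if_pos ha]

section Consistency

variable {p : Fin K → ℝ} {S : Matrix (Fin K) (Fin K) ℝ} {ρ : ℕ → ℝ}

lemma one_le_of_mem_theta {θ : Param K} (hθ : θ ∈ Theta K) : 1 ≤ K := by
  rcases Nat.eq_zero_or_pos K with h | h
  · subst h
    simpa using hθ.2.1
  · exact h

/-- No underestimation of the number of blocks. -/
lemma tendsto_law_criterion_lt_of_lt (hρ_pos : ∀ n, 0 < ρ n)
    (hρ : Tendsto (fun n : ℕ => (n : ℝ) * ρ n) atTop atTop)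
    (hΘ : ∀ n, (⟨p, ρ n • S⟩ : Param K) ∈ Theta K)
    (hS : ∀ a b : Fin K, a ≠ b → ∃ c, S c a ≠ S c b) (N : ℕ → ℝ) {B : ℕ → ℝ}
    (hB : B =o[atTop] (fun n : ℕ => (n : ℝ) ^ 2 * ρ n)) (hK' : 1 ≤ K') (hKK : K' < K) :
    Tendsto (fun n : ℕ => (law n (⟨p, ρ n • S⟩ : Param K)).real
      {G | criterion N (B n) G K' < criterion N (B n) G K}) atTop (𝓝 1) := by
  have hS0 : ∀ a b, 0 < S a b := fun a b =>
    pos_of_mul_pos_right ((hΘ 0).2.2.2 a b).1 (hρ_pos 0).le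
  obtain ⟨r, hr0, hr⟩ := exists_pos_forall_le (hΘ 0).1
  choose! c hc using hS
  obtain ⟨Δ, hΔ0, hΔ⟩ := exists_pos_forall_le
    (f := fun x : {x : Fin K × Fin K // x.1 ≠ x.2} =>
      (√(S (c x.1.1 x.1.2) x.1.1) - √(S (c x.1.1 x.1.2) x.1.2)) ^ 2) (fun x => by
      refine sq_pos_of_ne_zero (sub_ne_zero.2 fun h => hc _ _ x.2 ?_)
      exact (Real.sqrt_inj (hS0 _ _).le (hS0 _ _).le).1 h)
  have hKpos : (0 : ℝ) < K' := by exact_mod_cast hK'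
  set η := r / (2 * K') with hη
  have hη0 : 0 < η := by positivity
  set a := η ^ 2 * Δ / 16 with ha
  have ha0 : 0 < a := by positivity
  have hbad := tendsto_sum_labelProb_not_balanced (hΘ 0).1 (hΘ 0).2.1
  have hexp := Real.tendsto_exp_atBot.comp (tendsto_exponent_of_isLittleO hρ_pos hρ hB
    (Real.log K' + 2 * K' ^ 2 + (Real.log K' - Real.log r) / 2) (N K' - N K) ha0)
  have hlow := (hbad.const_sub 1).sub hexp
  rw [sub_zero, sub_zero] at hlow
  refine tendsto_of_tendsto_of_tendsto_of_le_of_le' hlow tendsto_const_nhds ?_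
    (Eventually.of_forall fun n => law_real_le_one (hΘ n) _)
  have hlarge := (tendsto_natCast_atTop_atTop (R := ℝ)).eventually_ge_atTop (2 / η)
  filter_upwards [hlarge] with n hn
  refine le_law_criterion_lt (hΘ n) (one_le_of_mem_theta (hΘ 0)) hK' N (B n) hr0 hr
    (a * ((n : ℝ) ^ 2 * ρ n)) (balanced p n) fun Z hZ z θ hθ => ?_
  have hηn : 2 ≤ η * n := by
    rw [div_le_iff₀ hη0] at hn
    linarith
  refine le_trans (le_of_eq ?_) (le_sum_sq_sub_of_lt hKK (hΘ n).2.2.1 hθ.2.2.1 Z z hηn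
    (mul_pos (hρ_pos n) hΔ0).le (fun b => ?_) fun b b' hbb => ⟨c b b', ?_⟩)
  · rw [ha]
    ring
  · refine le_trans ?_ (hZ b)
    have h1 : (K' : ℝ) * (η * n) = r * n / 2 := by
      rw [hη]
      field_simp
    rw [h1]
    have := hr b
    gcongr
  · have h1 := hΔ ⟨(b, b'), hbb⟩
    simp only [Matrix.smul_apply, smul_eq_mul, Real.sqrt_mul (hρ_pos n).le, ← mul_sub, mul_pow,
      Real.sq_sqrt (hρ_pos n).le]
    exact mul_le_mul_of_nonneg_left h1 (hρ_pos n).le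

/-- No overestimation of the number of blocks. -/
lemma tendsto_law_criterion_lt_of_gt (hρ_pos : ∀ n, 0 < ρ n)
    (hρ : Tendsto (fun n : ℕ => (n : ℝ) * ρ n) atTop atTop)
    (hΘ : ∀ n, (⟨p, ρ n • S⟩ : Param K) ∈ Theta K) {N : ℕ → ℝ}
    (hN : StrictMonoOn N (Set.Ici 1)) {B : ℕ → ℝ}
    (hB : Tendsto (fun n : ℕ => B n * (n : ℝ) ^ (-(3 / 2) : ℝ) * ρ n ^ (-(1 / 2) : ℝ)) atTop atTop)
    (hKK : K < K') :
    Tendsto (fun n : ℕ => (law n (⟨p, ρ n • S⟩ : Param K)).real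
      {G | criterion N (B n) G K' < criterion N (B n) G K}) atTop (𝓝 1) := by
  have hK := one_le_of_mem_theta (hΘ 0)
  obtain ⟨r, hr0, hr⟩ := exists_pos_forall_le (hΘ 0).1
  have hδ : 0 < N K' - N K := sub_pos.2 (hN hK (hK.trans hKK.le) hKK)
  have hlow := (Real.tendsto_exp_atBot.comp (tendsto_exponent_of_tendsto hρ_pos hρ hB
    (Real.log K' + 2 * K' ^ 2 + (Real.log K' - Real.log r) / 2) hδ)).const_sub 1
  rw [sub_zero] at hlow
  refine tendsto_of_tendsto_of_tendsto_of_le_of_le hlow tendsto_const_nhds (fun n => ?_)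
    fun n => law_real_le_one (hΘ n) _
  have := le_law_criterion_lt (hΘ n) hK (hK.trans hKK.le) N (B n) hr0 hr 0 (Set.univ : Set (Fin n → Fin K))
    fun Z _ z θ _ => by
      rw [mul_zero]
      exact Finset.sum_nonneg fun e _ => sq_nonneg _
  simpa using this

lemma tendsto_law_real_iInter {ι : Type*} (s : Finset ι) {θ : ℕ → Param K}
    (hθ : ∀ n, θ n ∈ Theta K) {E : ι → ∀ n, Set (SimpleGraph (Fin n))}
    (hE : ∀ i ∈ s, Tendsto (fun n => (law n (θ n)).real (E i n)) atTop (𝓝 1)) :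
    Tendsto (fun n => (law n (θ n)).real (⋂ i ∈ s, E i n)) atTop (𝓝 1) := by
  have hlow : Tendsto (fun n => 1 - ∑ i ∈ s, (1 - (law n (θ n)).real (E i n))) atTop (𝓝 1) := by
    have := (tendsto_finsetSum s fun i hi => (hE i hi).const_sub 1).const_sub 1
    simpa using this
  refine tendsto_of_tendsto_of_tendsto_of_le_of_le hlow tendsto_const_nhds (fun n => ?_)
    fun n => law_real_le_one (hθ n) _
  simp only
  rw [law_real_compl (hθ n) (⋂ i ∈ s, E i n)]
  refine sub_le_sub_left ?_ _
  rw [Set.compl_iInter₂]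
  refine (measureReal_biUnion_finset_le s _).trans (Finset.sum_le_sum fun i _ => ?_)
  rw [law_real_compl (hθ n) (E i n), sub_sub_cancel]

lemma selected_eq_singleton {N : ℕ → ℝ} {B : ℝ} {Kmax : ℕ} {G : SimpleGraph (Fin n)}
    (hK : K ∈ Set.Icc 1 Kmax)
    (h : ∀ k ∈ Set.Icc 1 Kmax, k ≠ K → criterion N B G k < criterion N B G K) :
    selected N B Kmax G = {K} := by
  ext k
  simp only [selected, Set.mem_ofPred_eq, Set.mem_singleton_iff]
  constructor
  · rintro ⟨hk, hmax⟩
    by_contra hne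
    exact absurd (h k hk hne) (not_lt.2 (hmax hK))
  · rintro rfl
    refine ⟨hK, fun j hj => ?_⟩
    by_cases hjk : j = k
    · rw [hjk]
      exact le_refl (criterion N B G k)
    · exact (h j hj hjk).le

end Consistency

end SBM

theorem corollary1 (K : ℕ) (p : Fin K → ℝ) (S : Matrix (Fin K) (Fin K) ℝ) (ρ : ℕ → ℝ)
    (hρ_pos : ∀ n, 0 < ρ n)
    (hρ : Tendsto (fun n : ℕ => (n : ℝ) * ρ n / Real.log n) atTop atTop)
    (hΘ : ∀ n, (⟨p, ρ n • S⟩ : SBM.Param K) ∈ SBM.Theta K)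
    (hS : ∀ a b : Fin K, a ≠ b → ∃ c, S c a ≠ S c b)
    (N : ℕ → ℝ) (hN : StrictMonoOn N (Set.Ici 1)) (B : ℕ → ℝ) :
    (B =o[atTop] (fun n : ℕ => (n : ℝ) ^ 2 * ρ n) →
      ∀ K' : ℕ, 1 ≤ K' → K' < K →
        Tendsto (fun n : ℕ => (SBM.law n (⟨p, ρ n • S⟩ : SBM.Param K)).real
          {G | SBM.criterion N (B n) G K' < SBM.criterion N (B n) G K}) atTop (𝓝 1)) ∧
    (Tendsto (fun n : ℕ => B n * (n : ℝ) ^ (-(3 / 2) : ℝ) * ρ n ^ (-(1 / 2) : ℝ)) atTop atTop →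
      ∀ K' : ℕ, K < K' →
        Tendsto (fun n : ℕ => (SBM.law n (⟨p, ρ n • S⟩ : SBM.Param K)).real
          {G | SBM.criterion N (B n) G K' < SBM.criterion N (B n) G K}) atTop (𝓝 1)) ∧
    (B =o[atTop] (fun n : ℕ => (n : ℝ) ^ 2 * ρ n) →
      Tendsto (fun n : ℕ => B n * (n : ℝ) ^ (-(3 / 2) : ℝ) * ρ n ^ (-(1 / 2) : ℝ)) atTop atTop →
      ∀ Kmax : ℕ, K ≤ Kmax →
        Tendsto (fun n : ℕ => (SBM.law n (⟨p, ρ n • S⟩ : SBM.Param K)).real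
          {G | SBM.selected N (B n) Kmax G = {K}}) atTop (𝓝 1)) := by
  have hρ' := SBM.tendsto_mul_of_div_log hρ_pos hρ
  refine ⟨fun hB K' hK' hKK => SBM.tendsto_law_criterion_lt_of_lt hρ_pos hρ' hΘ hS N hB hK' hKK,
    fun hB K' hKK => SBM.tendsto_law_criterion_lt_of_gt hρ_pos hρ' hΘ hN hB hKK,
    fun hB hB' Kmax hKmax => ?_⟩
  have hE : ∀ k ∈ (Finset.Icc 1 Kmax).erase K,
      Tendsto (fun n : ℕ => (SBM.law n (⟨p, ρ n • S⟩ : SBM.Param K)).real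
        {G | SBM.criterion N (B n) G k < SBM.criterion N (B n) G K}) atTop (𝓝 1) := by
    intro k hk
    obtain ⟨hne, hk⟩ := Finset.mem_erase.1 hk
    rcases lt_or_gt_of_ne hne with h | h
    · exact SBM.tendsto_law_criterion_lt_of_lt hρ_pos hρ' hΘ hS N hB (Finset.mem_Icc.1 hk).1 h
    · exact SBM.tendsto_law_criterion_lt_of_gt hρ_pos hρ' hΘ hN hB' h
  convert SBM.tendsto_law_real_iInter _ hΘ hE using 4 with n
  ext G
  simp only [Set.mem_ofPred_eq, Set.mem_iInter]
  have hK : K ∈ Set.Icc 1 Kmax := ⟨SBM.one_le_of_mem_theta (hΘ 0), hKmax⟩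
  constructor
  · intro h k hk
    obtain ⟨hne, hk⟩ := Finset.mem_erase.1 hk
    have hK' : K ∈ SBM.selected N (B n) Kmax G := h ▸ Set.mem_singleton K
    refine lt_of_le_of_ne (hK'.2 (Finset.mem_Icc.1 hk)) fun heq => hne ?_
    have : k ∈ SBM.selected N (B n) Kmax G :=
      ⟨Finset.mem_Icc.1 hk, fun j hj => (hK'.2 hj).trans_eq heq.symm⟩
    rwa [h] at this
  · intro h
    exact SBM.selected_eq_singleton hK fun k hk hne =>
      h k (Finset.mem_erase.2 ⟨hne, Finset.mem_Icc.2 hk⟩)
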